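/- A subset $U$ of a Hausdorff space $X$ is co-compact open if it is open and $X\setminus U$ is compact; a co-compact open cover is a cover of $X$ by such sets. A map $f:X\to X$ is perfect if it is continuous, closed, and all its fibres $f^{-1}(x)$ are compact. For a cover $\mathcal U$ let $N(\mathcal U)$ be the smallest cardinality of a subcover of $\mathcal U$ (finite if $\mathcal U$ is a co-compact open cover), and let $\bigvee_{i=0}^{n-1} f^{-i}(\mathcal U)=\{\bigcap_{i=0}^{n-1} f^{-i}(U_i) : U_0,\dots,U_{n-1}\in\mathcal U\}$. The co-compact entropy of a perfect map $f$ is $$c(f)=\sup_{\mathcal U}\ \lim_{n\to\infty}\frac1n\log N\Big(\bigvee_{i=0}^{n-1} f^{-i}(\mathcal U)\Big)\in[0,+\infty],$$ the supremum being over all co-compact open covers $\mathcal U$ of $X$ (the limit exists). A $p$-horseshoe for $g:\mathbb R\to\mathbb R$ is a tuple $(J_1,\dots,J_p)$ of pairwise disjoint closed bounded non-degenerate intervals of $\mathbb R$ with $J_1\cup\dots\cup J_p\subseteq g(J_i)$ for every $i=1,\dots,p$. **Theorem.** Let $f:\mathbb R\to\mathbb R$ be a perfect map with $c(f)>0$.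 Then for every real $\lambda$ with $0<\lambda<c(f)$ and every positive integer $N$ there are an integer $n\ge N$ and disjoint closed intervals $J_1,\dots,J_p$ such that $(J_1,\dots,J_p)$ is a $p$-horseshoe for $f^n$ (the $n$-th iterate of $f$) and $\frac{\log p}{n}\ge\lambda$. -/

import Mathlib

open Set Filter Topology

/-- A perfect map: continuous, closed, with compact fibres. -/
structure IsPerfectMap {X Y : Type*} [TopologicalSpace X] [TopologicalSpace Y] (f : X → Y) :
    Prop where
  continuous : Continuous f
  isClosedMap : IsClosedMap f
  isCompact_fiber : ∀ y, IsCompact (f ⁻¹' {y})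

/-- A cover of `X` by open sets each of which has compact complement. -/
structure IsCocompactOpenCover {X : Type*} [TopologicalSpace X] (U : Set (Set X)) : Prop where
  isOpen : ∀ u ∈ U, IsOpen u
  isCompact_compl : ∀ u ∈ U, IsCompact uᶜ
  sUnion_eq : ⋃₀ U = univ

/-- The set of cardinalities of the finite subcovers of `U`. -/
def subcoverCards {X : Type*} (U : Set (Set X)) : Set ℕ :=
  {k | ∃ V : Finset (Set X), (V : Set (Set X)) ⊆ U ∧ ⋃₀ (V : Set (Set X)) = univ ∧ V.card = k}

/-- `N(U)`: the smallest cardinality of a subcover of `U`. -/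
noncomputable def minSubcoverCard {X : Type*} (U : Set (Set X)) : ℕ :=
  sInf (subcoverCards U)

/-- The cover `U ∨ f⁻¹(U) ∨ ⋯ ∨ f^{-(n-1)}(U)`. -/
def iteratedJoin {X : Type*} (f : X → X) (U : Set (Set X)) (n : ℕ) : Set (Set X) :=
  {s | ∃ u : Fin n → Set X, (∀ i, u i ∈ U) ∧ s = ⋂ i : Fin n, f^[i] ⁻¹' u i}

/-- `H(U ∨ f⁻¹(U) ∨ ⋯ ∨ f^{-(n-1)}(U)) = log N(U ∨ f⁻¹(U) ∨ ⋯ ∨ f^{-(n-1)}(U))`. -/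
noncomputable def joinEntropy {X : Type*} (f : X → X) (U : Set (Set X)) (n : ℕ) : ℝ :=
  Real.log (minSubcoverCard (iteratedJoin f U n))

/-- The co-compact entropy `c(f, U)` of `f` relative to `U`. The limit exists for a perfect map
and a co-compact open cover, see `tendsto_coverEntropy`. -/
noncomputable def cocompactCoverEntropy {X : Type*} (f : X → X) (U : Set (Set X)) : ℝ :=
  limUnder atTop (fun n : ℕ => joinEntropy f U n / n)

/-- The co-compact entropy `c(f)`, the supremum of `c(f, U)` over all co-compact open covers;
it may be `+∞`. -/
noncomputable def cocompactEntropy {X : Type*} [TopologicalSpace X] (f : X → X) : EReal :=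
  ⨆ (U : Set (Set X)) (_ : IsCocompactOpenCover U), ((cocompactCoverEntropy f U : ℝ) : EReal)

/-- `(J 0, …, J (p - 1))` is a `p`-horseshoe for `g`: pairwise disjoint closed bounded
non-degenerate intervals, the image of each of which contains all of them. -/
structure IsHorseshoe (g : ℝ → ℝ) {p : ℕ} (J : Fin p → Set ℝ) : Prop where
  isInterval : ∀ i, ∃ a b : ℝ, a < b ∧ J i = Icc a b
  disjoint : ∀ i j, i ≠ j → Disjoint (J i) (J j)
  covers : ∀ i, (⋃ j, J j) ⊆ g '' J i

theorem IsPerfectMap.isProperMap {X Y : Type*} [TopologicalSpace X] [TopologicalSpace Y]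
    {f : X → Y} (hf : IsPerfectMap f) : IsProperMap f :=
  isProperMap_iff_isClosedMap_and_compact_fibers.2
    ⟨hf.continuous, hf.isClosedMap, hf.isCompact_fiber⟩

theorem IsCocompactOpenCover.subcoverCards_nonempty {X : Type*} [TopologicalSpace X]
    {U : Set (Set X)} (hU : IsCocompactOpenCover U) : (subcoverCards U).Nonempty := by
  classical
  rcases U.eq_empty_or_nonempty with h | ⟨u₀, hu₀⟩
  · refine ⟨0, ∅, by simp, ?_, rfl⟩
    have := hU.sUnion_eq
    rw [h] at this
    simpa using this
  · obtain ⟨T, hTU, hTf, hT⟩ := (hU.isCompact_compl u₀ hu₀).elim_finite_subcover_image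
      (b := U) (c := id) (fun u hu => hU.isOpen u hu)
      (by
        intro x _
        have hx : x ∈ ⋃₀ U := by rw [hU.sUnion_eq]; trivial
        simpa using hx)
    refine ⟨_, insert u₀ hTf.toFinset, ?_, ?_, rfl⟩
    · intro s hs
      simp only [Finset.coe_insert, Finite.coe_toFinset, mem_insert_iff] at hs
      rcases hs with rfl | hs
      · exact hu₀
      · exact hTU hs
    · refine eq_univ_of_forall fun x => ?_
      by_cases hx : x ∈ u₀
      · exact ⟨u₀, by simp, hx⟩
      · obtain ⟨s, hs, hxs⟩ := mem_iUnion₂.1 (hT hx)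
        exact ⟨s, by simp [hs], hxs⟩

theorem IsCocompactOpenCover.iteratedJoin {X : Type*} [TopologicalSpace X] {f : X → X}
    (hf : IsPerfectMap f) {U : Set (Set X)} (hU : IsCocompactOpenCover U) (n : ℕ) :
    IsCocompactOpenCover (iteratedJoin f U n) := by
  have hit : ∀ k : ℕ, IsProperMap f^[k] := by
    intro k
    induction k with
    | zero => exact isProperMap_id
    | succ k ih => exact ih.comp hf.isProperMap
  refine ⟨?_, ?_, ?_⟩
  · rintro s ⟨u, hu, rfl⟩
    exact isOpen_iInter_of_finite fun i => (hU.isOpen _ (hu i)).preimage (hit i).continuous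
  · rintro s ⟨u, hu, rfl⟩
    rw [compl_iInter]
    exact isCompact_iUnion fun i => by
      rw [← preimage_compl]
      exact (hit i).isCompact_preimage (hU.isCompact_compl _ (hu i))
  · refine eq_univ_of_forall fun x => ?_
    have h : ∀ y : X, ∃ u ∈ U, y ∈ u := fun y => by
      have hy : y ∈ ⋃₀ U := by rw [hU.sUnion_eq]; trivial
      exact hy
    choose u hu hyu using h
    exact ⟨_, ⟨fun i => u (f^[i] x), fun i => hu _, rfl⟩, mem_iInter.2 fun i => hyu _⟩

theorem subadditive_joinEntropy {X : Type*} [TopologicalSpace X] {f : X → X}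
    (hf : IsPerfectMap f) {U : Set (Set X)} (hU : IsCocompactOpenCover U) :
    Subadditive (joinEntropy f U) := by
  classical
  intro m n
  obtain ⟨V, hV, hVc, hVk⟩ := Nat.sInf_mem (hU.iteratedJoin hf m).subcoverCards_nonempty
  obtain ⟨W, hW, hWc, hWk⟩ := Nat.sInf_mem (hU.iteratedJoin hf n).subcoverCards_nonempty
  have key : minSubcoverCard (iteratedJoin f U (m + n)) ≤
      minSubcoverCard (iteratedJoin f U m) * minSubcoverCard (iteratedJoin f U n) := by
    have h1 : minSubcoverCard (iteratedJoin f U (m + n)) ≤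
        (Finset.image₂ (fun v w => v ∩ f^[m] ⁻¹' w) V W).card := by
      refine Nat.sInf_le ⟨_, ?_, ?_, rfl⟩
      · intro s hs
        obtain ⟨v, hv, w, hw, rfl⟩ := Finset.mem_image₂.1 (Finset.mem_coe.1 hs)
        obtain ⟨a, ha, rfl⟩ := hV hv
        obtain ⟨b, hb, rfl⟩ := hW hw
        refine ⟨Fin.append a b, ?_, ?_⟩
        · intro i
          refine Fin.addCases (fun j => ?_) (fun j => ?_) i
          · simpa using ha j
          · simpa using hb j
        · ext x
          simp only [mem_inter_iff, mem_iInter, mem_preimage]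
          constructor
          · rintro ⟨h1, h2⟩ i
            refine Fin.addCases (fun j => ?_) (fun j => ?_) i
            · simpa using h1 j
            · have := h2 j
              rw [← Function.iterate_add_apply, add_comm] at this
              simpa using this
          · intro h
            refine ⟨fun j => by simpa using h (Fin.castAdd n j), fun j => ?_⟩
            rw [← Function.iterate_add_apply, add_comm]
            simpa using h (Fin.natAdd m j)
      · refine eq_univ_of_forall fun x => ?_
        have hx : x ∈ ⋃₀ (V : Set (Set X)) := by rw [hVc]; trivial
        have hy : f^[m] x ∈ ⋃₀ (W : Set (Set X)) := by rw [hWc]; trivial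
        obtain ⟨v, hv, hxv⟩ := hx
        obtain ⟨w, hw, hyw⟩ := hy
        exact ⟨_, Finset.mem_coe.2 (Finset.mem_image₂_of_mem hv hw), hxv, hyw⟩
    refine h1.trans ((Finset.card_image₂_le _ _ _).trans ?_)
    rw [hVk, hWk]
    exact le_rfl
  unfold joinEntropy
  rcases Nat.eq_zero_or_pos (minSubcoverCard (iteratedJoin f U (m + n))) with h0 | h0
  · rw [h0]
    simpa using add_nonneg (Real.log_natCast_nonneg _) (Real.log_natCast_nonneg _)
  · have hp := Nat.pos_iff_ne_zero.1 (h0.trans_le key)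
    rw [← Real.log_mul (Nat.cast_ne_zero.2 (left_ne_zero_of_mul hp))
      (Nat.cast_ne_zero.2 (right_ne_zero_of_mul hp))]
    exact Real.log_le_log (Nat.cast_pos.2 h0) (by exact_mod_cast key)

theorem tendsto_coverEntropy {X : Type*} [TopologicalSpace X] {f : X → X}
    (hf : IsPerfectMap f) {U : Set (Set X)} (hU : IsCocompactOpenCover U) :
    Tendsto (fun n : ℕ => joinEntropy f U n / n) atTop (𝓝 (cocompactCoverEntropy f U)) :=
  tendsto_nhds_limUnder ⟨_, (subadditive_joinEntropy hf hU).tendsto_lim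
    ⟨0, by
      rintro _ ⟨n, rfl⟩
      exact div_nonneg (Real.log_natCast_nonneg _) (Nat.cast_nonneg n)⟩⟩

/-! Suppose no horseshoe of rate at least `lam` occurs for iterates of order at least `N`; then
every cover entropy is at most `lam`. Replace `f` by `g = f^[m]`, with `m` so large that `x = exp (m
* lam) ≥ 2`, and cut the line into finitely many intervals, each inside a member of the refined
cover. Subcovers of the iterated joins are then bounded by the number of label itineraries.

Track the interval of points reached along an itinerary. The image of an interval fills every cell
it meets except at most two, so partial steps alone multiply the count by at most `2 ≤ x`. Faster
growth can only come from itineraries that fill cells again and again. Full returns to one cell `A`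
in `k` steps yield disjoint intervals stretched by `g^[k]` across most of `A`, which is a horseshoe
up to one lost interval (`exists_horseshoe_of_fiber_eq_Ico`); on an unbounded cell properness leaves
at most two (`fullCount_le_two_of_not_isBounded`). Hence full returns are `O(x ^ k)`.

Cutting itineraries at the last full visit to a cell and inducting on the set of cells that may be
filled (`exists_wordCount_le`) bounds all itineraries by a polynomial times `x ^ n`, which gives
rate at most `lam`. -/

/-! ### Label itineraries and full visits -/

section Counting

variable {X ι : Type*}

/-- The points of `g(E)` that carry the label `B`. -/
def stepSet (g : X → X) (c : X → ι) (E : Set X) (B : ι) : Set X :=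
  g '' E ∩ c ⁻¹' {B}

open Classical in
/-- The number of label itineraries of `n` further steps starting in `E` for which a step that
fills the whole fibre of its label is only allowed when that label belongs to `S`. -/
noncomputable def wordCount [Fintype ι] (g : X → X) (c : X → ι) (S : Finset ι) : ℕ → Set X → ℕ
  | 0, _ => 1
  | n + 1, E => ∑ B, if (stepSet g c E B).Nonempty ∧ (stepSet g c E B = c ⁻¹' {B} → B ∈ S) then
      wordCount g c S n (stepSet g c E B) else 0

open Classical in
/-- The number of label itineraries of `k` further steps starting in `E` that end by filling the
whole fibre of `A`. -/
noncomputable def fullCount [Fintype ι] (g : X → X) (c : X → ι) (A : ι) : ℕ → Set X → ℕ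
  | 0, E => if E = c ⁻¹' {A} then 1 else 0
  | k + 1, E => ∑ B, fullCount g c A k (stepSet g c E B)

variable [Fintype ι] {g : X → X} {c : X → ι}

theorem fullCount_le_card_pow (A : ι) (k : ℕ) (E : Set X) :
    fullCount g c A k E ≤ Fintype.card ι ^ k := by
  induction k generalizing E with
  | zero => simp only [fullCount, pow_zero]; split_ifs <;> simp
  | succ k ih =>
    calc fullCount g c A (k + 1) E ≤ ∑ _B : ι, Fintype.card ι ^ k :=
          Finset.sum_le_sum fun B _ => ih _
      _ = Fintype.card ι ^ (k + 1) := by simp [pow_succ, mul_comm]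

open Classical in
/-- Decomposition of an itinerary at its last full visit to `A`. -/
theorem wordCount_le_erase_add_sum [DecidableEq ι] (S : Finset ι) {A : ι} (hA : (c ⁻¹' {A}).Nonempty) (n : ℕ)
    (E : Set X) :
    wordCount g c S n E ≤ (if E = c ⁻¹' {A} then 0 else wordCount g c (S.erase A) n E) +
      ∑ k ∈ Finset.range (n + 1),
        fullCount g c A k E * wordCount g c (S.erase A) (n - k) (c ⁻¹' {A}) := by
  induction n generalizing E with
  | zero =>
    by_cases h : E = c ⁻¹' {A} <;> simp [wordCount, fullCount, h]
  | succ n ih =>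
    have key : wordCount g c S (n + 1) E ≤ wordCount g c (S.erase A) (n + 1) E +
        ∑ k ∈ Finset.range (n + 1),
          fullCount g c A (k + 1) E * wordCount g c (S.erase A) (n - k) (c ⁻¹' {A}) := by
      have hsum : ∑ k ∈ Finset.range (n + 1),
          fullCount g c A (k + 1) E * wordCount g c (S.erase A) (n - k) (c ⁻¹' {A}) =
          ∑ B, ∑ k ∈ Finset.range (n + 1), fullCount g c A k (stepSet g c E B) *
            wordCount g c (S.erase A) (n - k) (c ⁻¹' {A}) := by
        rw [Finset.sum_comm]
        exact Finset.sum_congr rfl fun k _ => by rw [fullCount, Finset.sum_mul]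
      rw [hsum, wordCount, wordCount, ← Finset.sum_add_distrib]
      refine Finset.sum_le_sum fun B _ => ?_
      split_ifs with h1 h2 h2
      · refine (ih _).trans (Nat.add_le_add_right ?_ _)
        split_ifs <;> simp
      -- A step allowed by `S` but not by `S.erase A` must fill the fibre of `A`, so the `if` in the
      -- induction hypothesis vanishes.
      · refine (ih _).trans (Nat.add_le_add_right ?_ _)
        split_ifs with h3
        · exact le_rfl
        · refine absurd ⟨h1.1, fun h => Finset.mem_erase.2 ⟨?_, h1.2 h⟩⟩ h2
          rintro rfl
          exact h3 h
      · exact Nat.zero_le _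
      · exact Nat.zero_le _
    rw [Finset.sum_range_succ']
    simp only [Nat.add_sub_add_right, Nat.sub_zero]
    -- If `E` is already the fibre of `A`, the term `k = 0` supplies exactly the count that the `if`
    -- drops.
    by_cases h : E = c ⁻¹' {A}
    · subst h
      rw [if_pos rfl, zero_add, show fullCount g c A 0 (c ⁻¹' {A}) = 1 by simp [fullCount],
        one_mul]
      exact key.trans (add_comm _ _).le
    · rw [if_neg h]
      refine key.trans ?_
      rw [← add_assoc]
      exact Nat.le_add_right _ _

end Counting

/-! ### Growth of itineraries of intervals -/

theorem Set.OrdConnected.image_of_continuous {g : ℝ → ℝ} (hg : Continuous g) {E : Set ℝ}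
    (hE : E.OrdConnected) : (g '' E).OrdConnected :=
  (hE.isPreconnected.image g hg.continuousOn).ordConnected

section Interval

variable {ι : Type*} [LinearOrder ι] {g : ℝ → ℝ} {c : ℝ → ι}

theorem ordConnected_stepSet (hg : Continuous g) (hc : Monotone c) {E : Set ℝ}
    (hE : E.OrdConnected) (B : ι) : (stepSet g c E B).OrdConnected :=
  (hE.image_of_continuous hg).inter (ordConnected_singleton.preimage_mono hc)

variable [Fintype ι]

open Classical in
/-- An interval meets at most two fibres of a monotone labelling without containing them. -/
theorem card_filter_ne_fiber_le_two (hg : Continuous g) (hc : Monotone c) {E : Set ℝ}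
    (hE : E.OrdConnected) :
    (Finset.univ.filter fun B => (stepSet g c E B).Nonempty ∧
      stepSet g c E B ≠ c ⁻¹' {B}).card ≤ 2 := by
  by_contra! h
  set s := Finset.univ.filter fun B => (stepSet g c E B).Nonempty ∧ stepSet g c E B ≠ c ⁻¹' {B}
  -- The image is an interval, so it contains every fibre whose label lies strictly between two
  -- labels it meets.
  have hmid : ∀ a ∈ s, ∀ b ∈ s, ∀ d ∈ s, a < b → b < d → False := by
    intro a ha b hb d hd hab hbd
    obtain ⟨x, hxE, hxa⟩ := (Finset.mem_filter.1 ha).2.1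
    obtain ⟨z, hzE, hzd⟩ := (Finset.mem_filter.1 hd).2.1
    refine (Finset.mem_filter.1 hb).2.2 (inter_eq_right.2 fun y hy => ?_)
    simp only [mem_preimage, mem_singleton_iff] at hxa hzd hy
    refine (hE.image_of_continuous hg).out hxE hzE ⟨?_, ?_⟩
    · exact (hc.reflect_lt (by rw [hxa, hy]; exact hab)).le
    · exact (hc.reflect_lt (by rw [hzd, hy]; exact hbd)).le
  obtain ⟨a, b, d, ha, hb, hd, hab, had, hbd⟩ := Finset.two_lt_card_iff.1 h
  rcases lt_or_gt_of_ne hab with h1 | h1 <;> rcases lt_or_gt_of_ne had with h2 | h2 <;>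
    rcases lt_or_gt_of_ne hbd with h3 | h3
  · exact hmid a ha b hb d hd h1 h3
  · exact hmid a ha d hd b hb h2 h3
  · exact (lt_asymm (h1.trans h3) h2)
  · exact hmid d hd a ha b hb h2 h1
  · exact hmid b hb a ha d hd h1 h2
  · exact (lt_asymm (h1.trans h2) h3)
  · exact hmid b hb d hd a ha h3 h2
  · exact hmid d hd b hb a ha h3 h1

-- At most two first steps are partial, each followed by at most `M` words; every other step lands
-- on a whole fibre whose label lies in `S`.
open Classical in
theorem wordCount_succ_le (hg : Continuous g) (hc : Monotone c) (S : Finset ι) {n : ℕ} {M : ℝ}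
    (hM0 : 0 ≤ M) (hM : ∀ E : Set ℝ, E.OrdConnected → (wordCount g c S n E : ℝ) ≤ M) {E : Set ℝ}
    (hE : E.OrdConnected) :
    (wordCount g c S (n + 1) E : ℝ) ≤ 2 * M + ∑ B ∈ S, (wordCount g c S n (c ⁻¹' {B}) : ℝ) := by
  have h1 : (wordCount g c S (n + 1) E : ℝ) ≤
      ∑ B, ((if (stepSet g c E B).Nonempty ∧ stepSet g c E B ≠ c ⁻¹' {B} then M else 0) +
        (if B ∈ S then (wordCount g c S n (c ⁻¹' {B}) : ℝ) else 0)) := by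
    rw [wordCount, Nat.cast_sum]
    refine Finset.sum_le_sum fun B _ => ?_
    have hnn : (0 : ℝ) ≤ if B ∈ S then (wordCount g c S n (c ⁻¹' {B}) : ℝ) else 0 := by
      split_ifs <;> positivity
    by_cases hne : (stepSet g c E B).Nonempty
    · by_cases hf : stepSet g c E B = c ⁻¹' {B}
      · by_cases hBS : B ∈ S
        · simp [hf, hBS, hf ▸ hne]
        · simp [hf, hBS]
      · simp only [hne, hf, ne_eq, not_false_eq_true, and_self, if_true, false_imp_iff]
        linarith [hM _ (ordConnected_stepSet hg hc hE B)]
    · simp only [hne, false_and, if_false, Nat.cast_zero, zero_add]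
      exact hnn
  refine h1.trans ?_
  rw [Finset.sum_add_distrib, ← Finset.sum_filter, ← Finset.sum_filter, Finset.sum_const,
    nsmul_eq_mul]
  refine add_le_add (mul_le_mul_of_nonneg_right ?_ hM0) (le_of_eq ?_)
  · exact_mod_cast card_filter_ne_fiber_le_two hg hc hE
  · exact Finset.sum_congr (by ext; simp) fun _ _ => rfl

/-- If the full returns to each fibre grow at most like `x ^ k` with `2 ≤ x`, then so do all
itineraries, up to a polynomial factor. -/
theorem exists_wordCount_le (hg : Continuous g) (hc : Monotone c) (hs : Function.Surjective c)
    {x C : ℝ} (hx : 2 ≤ x) (hC : 0 ≤ C)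
    (hF : ∀ A k, (fullCount g c A k (c ⁻¹' {A}) : ℝ) ≤ C * x ^ k) (S : Finset ι) :
    ∃ (K : ℝ) (d : ℕ), 0 ≤ K ∧ ∀ n (E : Set ℝ), E.OrdConnected →
      (wordCount g c S n E : ℝ) ≤ K * (n + 1) ^ d * x ^ n := by
  have hx0 : 0 ≤ x := by linarith
  induction S using Finset.strongInduction with
  | H S ih =>
    -- Starting from a full fibre, the last-visit decomposition is a convolution of full returns
    -- with words over the smaller set `S.erase B`; its `n + 1` terms cost one polynomial degree.
    have hfib : ∃ (K : ℝ) (d : ℕ), 0 ≤ K ∧ ∀ n, ∀ B ∈ S,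
        (wordCount g c S n (c ⁻¹' {B}) : ℝ) ≤ K * (n + 1) ^ d * x ^ n := by
      choose! K d hK hKd using fun B (hB : B ∈ S) => ih _ (Finset.erase_ssubset hB)
      refine ⟨C * ∑ B ∈ S, K B, (∑ B ∈ S, d B) + 1,
        mul_nonneg hC (Finset.sum_nonneg hK), fun n B hB => ?_⟩
      have h := wordCount_le_erase_add_sum (g := g) S (A := B)
        (by obtain ⟨y, hy⟩ := hs B; exact ⟨y, hy⟩) n (c ⁻¹' {B})
      rw [if_pos rfl, zero_add] at h
      have hKle : K B ≤ ∑ B ∈ S, K B := Finset.single_le_sum hK hB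
      have hdle : d B ≤ ∑ B ∈ S, d B := Finset.single_le_sum (fun _ _ => Nat.zero_le _) hB
      have hterm : ∀ k ∈ Finset.range (n + 1), (fullCount g c B k (c ⁻¹' {B}) : ℝ) *
          wordCount g c (S.erase B) (n - k) (c ⁻¹' {B}) ≤
          C * (∑ B ∈ S, K B) * (n + 1) ^ (∑ B ∈ S, d B) * x ^ n := by
        intro k hk
        have hkn : k ≤ n := Nat.lt_succ_iff.1 (Finset.mem_range.1 hk)
        have hw := hKd B hB (n - k) (c ⁻¹' {B}) (ordConnected_singleton.preimage_mono hc)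
        have hpow : (((n - k : ℕ) : ℝ) + 1) ^ d B ≤ ((n : ℝ) + 1) ^ (∑ B ∈ S, d B) := by
          refine (pow_le_pow_left₀ (by positivity) ?_ _).trans
            (pow_le_pow_right₀ (by linarith [Nat.cast_nonneg (α := ℝ) n]) hdle)
          have : ((n - k : ℕ) : ℝ) ≤ n := by exact_mod_cast Nat.sub_le n k
          linarith
        have hS0 : 0 ≤ ∑ B ∈ S, K B := Finset.sum_nonneg hK
        calc _ ≤ (C * x ^ k) * (K B * (((n - k : ℕ) : ℝ) + 1) ^ d B * x ^ (n - k)) :=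
              mul_le_mul (hF B k) hw (by positivity) (by positivity)
          _ = C * (K B * (((n - k : ℕ) : ℝ) + 1) ^ d B) * x ^ n := by
              rw [← pow_mul_pow_sub x hkn]; ring
          _ ≤ C * ((∑ B ∈ S, K B) * (n + 1) ^ (∑ B ∈ S, d B)) * x ^ n := by gcongr
          _ = _ := by ring
      calc (wordCount g c S n (c ⁻¹' {B}) : ℝ) ≤ ∑ k ∈ Finset.range (n + 1),
            (fullCount g c B k (c ⁻¹' {B}) : ℝ) *
              wordCount g c (S.erase B) (n - k) (c ⁻¹' {B}) := by exact_mod_cast h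
        _ ≤ ∑ k ∈ Finset.range (n + 1),
            C * (∑ B ∈ S, K B) * (n + 1) ^ (∑ B ∈ S, d B) * x ^ n := Finset.sum_le_sum hterm
        _ = _ := by rw [Finset.sum_const, Finset.card_range, nsmul_eq_mul]; push_cast; ring
    obtain ⟨K, d, hK, hKd⟩ := hfib
    have hL0 : (0 : ℝ) ≤ 1 + S.card * K := by positivity
    -- The summand `1` handles `n = 0`. The recursion closes because `2 ≤ x` and `(n+1)^(d+1) +
    -- (n+1)^d = (n+1)^d * (n+2)`.
    refine ⟨1 + S.card * K, d + 1, hL0, fun n => ?_⟩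
    induction n with
    | zero =>
      intro E _
      simp only [wordCount, Nat.cast_one, Nat.cast_zero, zero_add, one_pow, pow_zero, mul_one]
      linarith [mul_nonneg (Nat.cast_nonneg (α := ℝ) S.card) hK]
    | succ n ihn =>
      intro E hE
      have hsum : ∑ B ∈ S, (wordCount g c S n (c ⁻¹' {B}) : ℝ) ≤
          (1 + S.card * K) * (n + 1) ^ d * x ^ n := by
        calc _ ≤ ∑ B ∈ S, K * (n + 1) ^ d * x ^ n := Finset.sum_le_sum fun B hB => hKd n B hB
          _ = (S.card * K) * (n + 1) ^ d * x ^ n := by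
              rw [Finset.sum_const, nsmul_eq_mul]; ring
          _ ≤ _ := by gcongr; linarith
      have h := wordCount_succ_le hg hc S (n := n) (by positivity) ihn hE
      set L := 1 + (S.card : ℝ) * K
      calc _ ≤ 2 * (L * (n + 1) ^ (d + 1) * x ^ n) + L * (n + 1) ^ d * x ^ n := by linarith
        _ ≤ x * (L * (n + 1) ^ (d + 1) * x ^ n) + x * (L * (n + 1) ^ d * x ^ n) := by
            have h1 : (0 : ℝ) ≤ L * (n + 1) ^ (d + 1) * x ^ n := by positivity
            have h2 : (0 : ℝ) ≤ L * (n + 1) ^ d * x ^ n := by positivity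
            nlinarith
        _ = L * ((n + 1) ^ d * (n + 1 + 1)) * x ^ (n + 1) := by ring
        _ ≤ L * ((n + 1 + 1) ^ d * (n + 1 + 1)) * x ^ (n + 1) := by
            gcongr
            linarith
        _ = _ := by push_cast; ring

end Interval

/-! ### Pulling intervals back along itineraries -/

/-- Take `l` as the last point with value `g p` and `r` as the first later point with value `g q`.
Leaving the range in between would, by the intermediate value theorem, produce a later `l` or an
earlier `r`. -/
theorem exists_mapsTo_uIcc_of_lt {g : ℝ → ℝ} (hg : Continuous g) {p q : ℝ} (hpq : p ≤ q)
    (h : g p < g q) :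
    ∃ l ∈ Icc p q, ∃ r ∈ Icc p q, g l = g p ∧ g r = g q ∧
      MapsTo g (uIcc l r) (uIcc (g p) (g q)) := by
  obtain ⟨l, ⟨hl, hgl⟩, hlmax⟩ : ∃ l, IsGreatest (Icc p q ∩ g ⁻¹' {g p}) l :=
    (isCompact_Icc.inter_right (isClosed_singleton.preimage hg)).exists_isGreatest
      ⟨p, left_mem_Icc.2 hpq, rfl⟩
  obtain ⟨r, ⟨hr, hgr⟩, hrmin⟩ : ∃ r, IsLeast (Icc l q ∩ g ⁻¹' {g q}) r :=
    (isCompact_Icc.inter_right (isClosed_singleton.preimage hg)).exists_isLeast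
      ⟨q, right_mem_Icc.2 hl.2, rfl⟩
  simp only [mem_preimage, mem_singleton_iff] at hgl hgr
  refine ⟨l, hl, r, ⟨hl.1.trans hr.1, hr.2⟩, hgl, hgr, ?_⟩
  rw [uIcc_of_le hr.1, uIcc_of_le h.le]
  intro t ht
  by_contra hcon
  rw [mem_Icc, not_and_or, not_le, not_le] at hcon
  rcases hcon with hlt | hlt
  · obtain ⟨s, hs, hgs⟩ := intermediate_value_Icc ht.2 hg.continuousOn
      (show g p ∈ Icc (g t) (g r) from ⟨hlt.le, hgr ▸ h.le⟩)
    have := hlmax ⟨⟨(hl.1.trans ht.1).trans hs.1, hs.2.trans hr.2⟩, hgs⟩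
    have htl : t = l := le_antisymm (hs.1.trans this) ht.1
    rw [htl, hgl] at hlt
    exact lt_irrefl _ hlt
  · obtain ⟨s, hs, hgs⟩ := intermediate_value_Icc ht.1 hg.continuousOn
      (show g q ∈ Icc (g l) (g t) from ⟨hgl ▸ h.le, hlt.le⟩)
    have := hrmin ⟨⟨hs.1, (hs.2.trans ht.2).trans hr.2⟩, hgs⟩
    have htr : t = r := le_antisymm ht.2 (this.trans hs.2)
    rw [htr, hgr] at hlt
    exact lt_irrefl _ hlt

theorem exists_mapsTo_uIcc_of_le {g : ℝ → ℝ} (hg : Continuous g) {p q : ℝ} (hpq : p ≤ q) :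
    ∃ l ∈ Icc p q, ∃ r ∈ Icc p q, g l = g p ∧ g r = g q ∧
      MapsTo g (uIcc l r) (uIcc (g p) (g q)) := by
  rcases lt_trichotomy (g p) (g q) with h | h | h
  · exact exists_mapsTo_uIcc_of_lt hg hpq h
  · refine ⟨p, left_mem_Icc.2 hpq, p, left_mem_Icc.2 hpq, rfl, h, ?_⟩
    intro t ht
    rw [uIcc_self, mem_singleton_iff] at ht
    exact ht ▸ left_mem_uIcc
  · obtain ⟨l, hl, r, hr, h1, h2, h3⟩ :=
      exists_mapsTo_uIcc_of_lt hg.neg hpq (show -g p < -g q by linarith)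
    refine ⟨l, hl, r, hr, neg_inj.1 h1, neg_inj.1 h2, fun t ht => ?_⟩
    have := h3 ht
    simp only [mem_uIcc, Pi.neg_apply, neg_le_neg_iff] at this
    exact mem_uIcc.2 (this.symm.imp And.symm And.symm)

/-- Two points of the image of an interval are the images of the ends of a subinterval that is
mapped between them. -/
theorem Set.OrdConnected.exists_mapsTo_uIcc {g : ℝ → ℝ} (hg : Continuous g) {E : Set ℝ}
    (hE : E.OrdConnected) {x y : ℝ} (hx : x ∈ g '' E) (hy : y ∈ g '' E) :
    ∃ l r, uIcc l r ⊆ E ∧ g l = x ∧ g r = y ∧ MapsTo g (uIcc l r) (uIcc x y) := by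
  obtain ⟨p, hp, rfl⟩ := hx
  obtain ⟨q, hq, rfl⟩ := hy
  rcases le_total p q with h | h
  · obtain ⟨l, hl, r, hr, h1, h2, h3⟩ := exists_mapsTo_uIcc_of_le hg h
    exact ⟨l, r, hE.uIcc_subset (hE.out hp hq hl) (hE.out hp hq hr), h1, h2, h3⟩
  · obtain ⟨l, hl, r, hr, h1, h2, h3⟩ := exists_mapsTo_uIcc_of_le hg h
    refine ⟨r, l, hE.uIcc_subset (hE.out hq hp hr) (hE.out hq hp hl), h2, h1, ?_⟩
    rwa [uIcc_comm r, uIcc_comm (g p)]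

/-- Full itineraries are realized by pairwise disjoint compact intervals. -/
theorem exists_disjoint_uIcc {ι : Type} [Fintype ι] [LinearOrder ι] {g : ℝ → ℝ} {c : ℝ → ι}
    (hg : Continuous g) (hc : Monotone c) {A : ι} {x y : ℝ} (hx : c x = A) (hy : c y = A)
    (k : ℕ) (E : Set ℝ) (hE : E.OrdConnected) :
    ∃ (W : Type) (_ : Fintype W) (l r : W → ℝ), Fintype.card W = fullCount g c A k E ∧
      (∀ w, uIcc (l w) (r w) ⊆ E) ∧ (∀ w, g^[k] (l w) = x) ∧ (∀ w, g^[k] (r w) = y) ∧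
      ∀ w w', w ≠ w' → Disjoint (uIcc (l w) (r w)) (uIcc (l w') (r w')) := by
  induction k generalizing E with
  | zero =>
    by_cases h : E = c ⁻¹' {A}
    · refine ⟨Unit, inferInstance, fun _ => x, fun _ => y, by simp [fullCount, h], ?_,
        fun _ => rfl, fun _ => rfl, fun w w' hw => (hw rfl).elim⟩
      intro _
      refine hE.uIcc_subset ?_ ?_ <;> rw [h] <;> assumption
    · exact ⟨Empty, inferInstance, Empty.elim, Empty.elim, by simp [fullCount, h],
        fun w => w.elim, fun w => w.elim, fun w => w.elim, fun w => w.elim⟩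
  | succ k ih =>
    choose W hW l r hcard hsub hl hr hdis using fun B =>
      ih (stepSet g c E B) (ordConnected_stepSet hg hc hE B)
    have hpull : ∀ w : Σ B, W B, ∃ l' r', uIcc l' r' ⊆ E ∧ g l' = l w.1 w.2 ∧ g r' = r w.1 w.2 ∧
        MapsTo g (uIcc l' r') (uIcc (l w.1 w.2) (r w.1 w.2)) := fun w =>
      hE.exists_mapsTo_uIcc hg (hsub _ _ left_mem_uIcc).1 (hsub _ _ right_mem_uIcc).1
    choose l' r' hE' hl' hr' hmap using hpull
    refine ⟨Σ B, W B, inferInstance, l', r', ?_, hE', ?_, ?_, ?_⟩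
    · rw [Fintype.card_sigma, fullCount]
      exact Finset.sum_congr rfl fun B _ => hcard B
    · intro w
      rw [Function.iterate_succ_apply, hl', hl]
    · intro w
      rw [Function.iterate_succ_apply, hr', hr]
    -- A common point `z` forces the first labels to agree, both being `c (g z)`; then `g z` lies in
    -- two intervals already known to be disjoint.
    · rintro ⟨B, w⟩ ⟨B', w'⟩ hne
      rw [Set.disjoint_left]
      intro z hz hz'
      have h1 := hmap _ hz
      have h2 := hmap _ hz'
      have hB : c (g z) = B := (hsub _ _ h1).2
      have hB' : c (g z) = B' := (hsub _ _ h2).2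
      obtain rfl : B = B' := hB.symm.trans hB'
      exact Set.disjoint_left.1 (hdis B w w' fun h => hne (by rw [h])) h1 h2

/-! ### Full returns: horseshoes and properness -/

/-- Pairwise disjoint sets through a common point are equal, so all but one avoid it. -/
theorem card_le_card_subtype_add_one {W : Type} [Fintype W] {J : W → Set ℝ}
    (hJ : ∀ w w', w ≠ w' → Disjoint (J w) (J w')) (y : ℝ) (P : W → Prop) [DecidablePred P]
    (hP : ∀ w, ¬ P w → y ∈ J w) : Fintype.card W ≤ Fintype.card {w // P w} + 1 := by
  have h1 : Fintype.card {w // ¬ P w} ≤ 1 := by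
    refine Fintype.card_le_one_iff.2 fun w w' => ?_
    by_contra hne
    exact Set.disjoint_left.1 (hJ w w' fun h => hne (Subtype.ext h)) (hP _ w.2) (hP _ w'.2)
  have h2 := Fintype.card_subtype_compl P
  have h3 := Fintype.card_subtype_le P
  omega

/-- Full returns to a bounded fibre give a horseshoe. -/
theorem exists_horseshoe_of_fiber_eq_Ico {ι : Type} [Fintype ι] [LinearOrder ι] {g : ℝ → ℝ}
    {c : ℝ → ι} (hg : Continuous g) (hc : Monotone c) {A : ι} {a b : ℝ} (hab : a < b)
    (hA : c ⁻¹' {A} = Ico a b) (k : ℕ) :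
    ∃ (p : ℕ) (J : Fin p → Set ℝ), IsHorseshoe g^[k] J ∧
      fullCount g c A k (c ⁻¹' {A}) ≤ p + 1 := by
  classical
  have hgk : Continuous g^[k] := hg.iterate k
  obtain ⟨δ, hδ, hosc⟩ := Metric.continuousAt_iff.1 (hgk.continuousAt (x := b)) ((b - a) / 4)
    (by linarith)
  -- `y` is at least `(b - a) / 2` away from `a`, while on `(y, b)` the iterate stays within `(b -
  -- a) / 4` of its value at `b`.
  set y := max (b - δ / 2) ((a + b) / 2) with hy
  have hyb : y < b := max_lt (by linarith) (by linarith)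
  have hy1 : b - δ / 2 ≤ y := le_max_left _ _
  have hy2 : (a + b) / 2 ≤ y := le_max_right _ _
  have hyA : y ∈ c ⁻¹' {A} := by rw [hA]; constructor <;> linarith
  have haA : a ∈ c ⁻¹' {A} := by rw [hA]; exact ⟨le_rfl, hab⟩
  obtain ⟨W, _, l, r, hcard, hsub, hl, hr, hdis⟩ := exists_disjoint_uIcc hg hc haA hyA k
    (c ⁻¹' {A}) (ordConnected_singleton.preimage_mono hc)
  -- An interval inside `(y, b)` could not have end values `a` and `y`, so one that leaves `[a, y]`
  -- contains `y`. Disjointness allows only one of these, and it is discarded.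
  have hcross : ∀ w, ¬ uIcc (l w) (r w) ⊆ Icc a y → y ∈ uIcc (l w) (r w) := by
    intro w hw
    obtain ⟨t, ht, hty⟩ := not_subset.1 hw
    have htA := hsub w ht
    rw [hA] at htA
    have hyt : y < t := by
      by_contra h
      exact hty ⟨htA.1, not_lt.1 h⟩
    by_contra hyJ
    have hright : ∀ s ∈ uIcc (l w) (r w), dist (g^[k] s) (g^[k] b) < (b - a) / 4 := by
      intro s hs
      have hsA := hsub w hs
      rw [hA] at hsA
      have hys : y < s := by
        by_contra h
        exact hyJ (ordConnected_uIcc.out hs ht ⟨not_lt.1 h, hyt.le⟩)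
      refine hosc ?_
      rw [Real.dist_eq, abs_lt]
      constructor <;> linarith [hsA.2]
    have h1 := hright _ left_mem_uIcc
    have h2 := hright _ right_mem_uIcc
    rw [hl, Real.dist_eq, abs_lt] at h1
    rw [hr, Real.dist_eq, abs_lt] at h2
    linarith [h1.1, h2.2]
  have hle := card_le_card_subtype_add_one hdis y _ hcross
  set e := (Fintype.equivFin {w // uIcc (l w) (r w) ⊆ Icc a y}).symm
  refine ⟨_, fun i => uIcc (l (e i)) (r (e i)), ⟨?_, ?_, ?_⟩, hcard ▸ hle⟩
  · intro i
    refine ⟨_, _, ?_, rfl⟩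
    rw [inf_lt_sup]
    intro h
    have := hl (e i)
    rw [h, hr] at this
    linarith
  · intro i j hij
    exact hdis _ _ fun h => hij (e.injective (Subtype.ext h))
  · intro i
    refine iUnion_subset fun j => (e j).2.trans ?_
    have h := intermediate_value_uIcc (a := l (e i)) (b := r (e i)) hgk.continuousOn
    rwa [hl, hr, uIcc_of_le (by linarith)] at h

/-- A proper map has at most two full returns to an unbounded fibre. -/
theorem fullCount_le_two_of_not_isBounded {ι : Type} [Fintype ι] [LinearOrder ι] {g : ℝ → ℝ}
    {c : ℝ → ι} (hg : IsProperMap g) (hc : Monotone c) {A : ι}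
    (hA : ¬ Bornology.IsBounded (c ⁻¹' {A})) (k : ℕ) :
    fullCount g c A k (c ⁻¹' {A}) ≤ 2 := by
  classical
  have hgk : IsProperMap g^[k] := by
    induction k with
    | zero => exact isProperMap_id
    | succ k ih => exact ih.comp hg
  obtain ⟨x, hx⟩ : (c ⁻¹' {A}).Nonempty := by
    by_contra h
    exact hA (by simp [not_nonempty_iff_eq_empty.1 h])
  obtain ⟨R, hR⟩ := (hgk.isCompact_preimage
    (isCompact_singleton (x := x))).isBounded.subset_closedBall 0
  rw [Real.closedBall_eq_Icc, zero_sub, zero_add] at hR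
  -- All `g^[k]`-preimages of `x` lie in `[-R, R]` and none of `y` do, so each interval from `x` to
  -- `y` passes through `R` or `-R`.
  obtain ⟨y, hyA, hy⟩ : ∃ y ∈ c ⁻¹' {A}, y ∉ g^[k] '' Icc (-R) R := by
    by_contra! h
    exact hA ((isCompact_Icc.image hgk.continuous).isBounded.subset h)
  obtain ⟨W, _, l, r, hcard, hsub, hl, hr, hdis⟩ := exists_disjoint_uIcc hg.continuous hc hx hyA k
    (c ⁻¹' {A}) (ordConnected_singleton.preimage_mono hc)
  have hcross : ∀ w, -R ∈ uIcc (l w) (r w) ∨ R ∈ uIcc (l w) (r w) := by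
    intro w
    have h1 : l w ∈ Icc (-R) R := hR (hl w)
    have h2 : r w ∉ Icc (-R) R := fun h => hy ⟨_, h, hr w⟩
    rw [mem_Icc, not_and_or, not_le, not_le] at h2
    rcases h2 with h2 | h2
    · exact Or.inl (mem_uIcc.2 (Or.inr ⟨h2.le, h1.1⟩))
    · exact Or.inr (mem_uIcc.2 (Or.inl ⟨h1.2, h2.le⟩))
  rw [← hcard]
  refine (card_le_card_subtype_add_one hdis (-R) (fun w => R ∈ uIcc (l w) (r w))
    fun w hw => (hcross w).resolve_right hw).trans (Nat.add_le_add_right ?_ 1)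
  refine Fintype.card_le_one_iff.2 fun w w' => ?_
  by_contra hne
  exact Set.disjoint_left.1 (hdis w w' fun h => hne (Subtype.ext h)) w.2 w'.2

/-! ### A finite interval partition subordinate to the cover -/

/-- A co-compact open cover of the line is refined by the fibres of a finite monotone labelling,
each of which is half-open or unbounded. -/
theorem IsCocompactOpenCover.exists_monotone_labelling {U : Set (Set ℝ)}
    (hU : IsCocompactOpenCover U) :
    ∃ (K : ℕ) (c : ℝ → Fin (K + 1)), Monotone c ∧ Function.Surjective c ∧
      (∀ A, ∃ u ∈ U, c ⁻¹' {A} ⊆ u) ∧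
      ∀ A, (∃ a b, a < b ∧ c ⁻¹' {A} = Ico a b) ∨ ¬ Bornology.IsBounded (c ⁻¹' {A}) := by
  obtain ⟨u₀, hu₀, -⟩ : (0 : ℝ) ∈ ⋃₀ U := by rw [hU.sUnion_eq]; trivial
  obtain ⟨R, hR0, hR⟩ := (hU.isCompact_compl u₀ hu₀).isBounded.subset_closedBall_lt 0 0
  rw [Real.closedBall_eq_Icc, zero_sub, zero_add] at hR
  have hout : ∀ x, x ∉ Icc (-R) R → x ∈ u₀ := fun x hx => by
    by_contra h
    exact hx (hR h)
  obtain ⟨δ, hδ, hleb⟩ := lebesgue_number_lemma_of_metric_sUnion (s := Icc (-R) R)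
    isCompact_Icc hU.isOpen (by rw [hU.sUnion_eq]; exact subset_univ _)
  obtain ⟨K, hK⟩ := exists_nat_gt (2 * R / δ + 1)
  have hK1 : (1 : ℝ) < K := by linarith [div_pos (mul_pos two_pos hR0) hδ]
  have hKpos : 1 < K := by exact_mod_cast hK1
  have hKR : 2 * R < (K - 1) * δ := (div_lt_iff₀ hδ).1 (by linarith)
  -- A grid of mesh `δ` starting at `-R`. The shift by one and truncation of the floor at `0` put
  -- all of `x < -R` in cell `0`; the cap at `K` gives a last ray, which starts beyond `R` by `hKR`.
  let c : ℝ → Fin (K + 1) := fun x =>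
    ⟨min ⌊(x + R) / δ + 1⌋₊ K, Nat.lt_succ_of_le (min_le_right _ _)⟩
  have hcval : ∀ x A, c x = A ↔ min ⌊(x + R) / δ + 1⌋₊ K = (A : ℕ) := fun x A => Fin.ext_iff
  have hfirst : ∀ A : Fin (K + 1), (A : ℕ) = 0 → c ⁻¹' {A} = Iio (-R) := by
    intro A hA
    ext x
    have h1 : min ⌊(x + R) / δ + 1⌋₊ K = 0 ↔ ⌊(x + R) / δ + 1⌋₊ = 0 := by omega
    rw [mem_preimage, mem_singleton_iff, hcval, hA, h1, Nat.floor_eq_zero, mem_Iio,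
      add_lt_iff_neg_right, div_lt_iff₀ hδ]
    constructor <;> intro h <;> linarith
  have hlast : ∀ A : Fin (K + 1), (A : ℕ) = K → c ⁻¹' {A} = Ici (-R + (K - 1) * δ) := by
    intro A hA
    ext x
    have h1 : min ⌊(x + R) / δ + 1⌋₊ K = K ↔ K ≤ ⌊(x + R) / δ + 1⌋₊ := by omega
    rw [mem_preimage, mem_singleton_iff, hcval, hA, h1, Nat.le_floor_iff' (by omega), mem_Ici,
      ← sub_le_iff_le_add, le_div_iff₀ hδ]
    constructor <;> intro h <;> linarith
  have hmid : ∀ A : Fin (K + 1), (A : ℕ) ≠ 0 → (A : ℕ) ≠ K →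
      c ⁻¹' {A} = Ico (-R + (A - 1) * δ) (-R + A * δ) := by
    intro A hA0 hAK
    ext x
    have h1 : min ⌊(x + R) / δ + 1⌋₊ K = A ↔ ⌊(x + R) / δ + 1⌋₊ = A := by omega
    rw [mem_preimage, mem_singleton_iff, hcval, h1, Nat.floor_eq_iff' hA0, mem_Ico,
      ← sub_le_iff_le_add, le_div_iff₀ hδ, add_lt_add_iff_right, div_lt_iff₀ hδ]
    constructor <;> rintro ⟨h, h'⟩ <;> constructor <;> linarith
  refine ⟨K, c, ?_, ?_, ?_, ?_⟩
  · intro x y hxy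
    have : ⌊(x + R) / δ + 1⌋₊ ≤ ⌊(y + R) / δ + 1⌋₊ := Nat.floor_mono (by gcongr)
    exact min_le_min_right K this
  · intro A
    refine ⟨-R + (A - 1) * δ, (hcval _ _).2 ?_⟩
    rw [show (-R + ((A : ℕ) - 1) * δ + R) / δ + 1 = ((A : ℕ) : ℝ) by field_simp; ring,
      Nat.floor_natCast]
    exact min_eq_left (Nat.lt_succ_iff.1 A.2)
  · intro A
    by_cases hA0 : (A : ℕ) = 0
    · refine ⟨u₀, hu₀, fun x hx => hout x fun h => ?_⟩
      rw [hfirst A hA0] at hx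
      exact not_le.2 hx h.1
    by_cases hAK : (A : ℕ) = K
    · refine ⟨u₀, hu₀, fun x hx => hout x fun h => ?_⟩
      rw [hlast A hAK, mem_Ici] at hx
      linarith [h.2]
    have hA1 : (1 : ℝ) ≤ (A : ℕ) := by exact_mod_cast Nat.one_le_iff_ne_zero.2 hA0
    rw [hmid A hA0 hAK]
    -- A cell starting in `[-R, R]` lies in the Lebesgue ball about its left end; a cell starting
    -- beyond `R` lies in `u₀`.
    by_cases hle : -R + (((A : ℕ) : ℝ) - 1) * δ ≤ R
    · obtain ⟨u, hu, hsub⟩ := hleb (-R + (((A : ℕ) : ℝ) - 1) * δ)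
        ⟨by linarith [mul_nonneg (sub_nonneg.2 hA1) hδ.le], hle⟩
      refine ⟨u, hu, fun x hx => hsub ?_⟩
      rw [Metric.mem_ball, Real.dist_eq, abs_lt]
      constructor <;> linarith [hx.1, hx.2]
    · refine ⟨u₀, hu₀, fun x hx => hout x fun h => ?_⟩
      linarith [h.2, hx.1]
  · intro A
    by_cases hA0 : (A : ℕ) = 0
    · right
      rw [hfirst A hA0]
      exact fun h => not_bddBelow_Iio _ h.bddBelow
    by_cases hAK : (A : ℕ) = K
    · right
      rw [hlast A hAK]
      exact fun h => not_bddAbove_Ici _ h.bddAbove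
    · exact Or.inl ⟨_, _, by linarith, hmid A hA0 hAK⟩

/-! ### From itineraries to subcovers -/

section Cover

variable {X ι : Type*} [Fintype ι] {g : X → X} {c : X → ι} {U : Set (Set X)}

/-- Each word picks one member of `U` per label. The starting label counts as well, so `n` steps
give a join of length `n + 1`; with `Finset.univ` no full step is forbidden. -/
theorem exists_finset_iteratedJoin_cover (hc : ∀ A, ∃ u ∈ U, c ⁻¹' {A} ⊆ u) (n : ℕ) (E : Set X)
    {A : ι} (hE : E ⊆ c ⁻¹' {A}) :
    ∃ V : Finset (Set X), (V : Set (Set X)) ⊆ iteratedJoin g U (n + 1) ∧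
      E ⊆ ⋃₀ (V : Set (Set X)) ∧ V.card ≤ wordCount g c Finset.univ n E := by
  classical
  induction n generalizing E A with
  | zero =>
    obtain ⟨u, hu, hAu⟩ := hc A
    refine ⟨{u}, ?_, ?_, by simp [wordCount]⟩
    · rintro _ hs
      obtain rfl : _ = u := by simpa using hs
      exact ⟨fun _ => _, fun _ => hu, by ext; simp⟩
    · simpa using hE.trans hAu
  | succ n ih =>
    obtain ⟨u, hu, hAu⟩ := hc A
    choose V hV hcov hcard using fun B =>
      ih (stepSet g c E B) (A := B) inter_subset_right
    refine ⟨Finset.univ.biUnion fun B => if (stepSet g c E B).Nonempty then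
      (V B).image fun s => u ∩ g ⁻¹' s else ∅, ?_, ?_, ?_⟩
    · intro s hs
      obtain ⟨B, -, hsB⟩ := Finset.mem_biUnion.1 (Finset.mem_coe.1 hs)
      split_ifs at hsB with hne
      · obtain ⟨t, ht, rfl⟩ := Finset.mem_image.1 hsB
        obtain ⟨v, hv, rfl⟩ := hV B ht
        refine ⟨Fin.cons u v, fun i => ?_, ?_⟩
        · refine Fin.cases ?_ (fun j => ?_) i
          · simpa using hu
          · simpa using hv j
        · ext x
          simp [Fin.forall_fin_succ]
      · simp at hsB
    · intro x hx
      have hstep : g x ∈ stepSet g c E (c (g x)) := ⟨mem_image_of_mem g hx, rfl⟩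
      obtain ⟨s, hs, hxs⟩ := hcov _ hstep
      refine ⟨u ∩ g ⁻¹' s, ?_, hAu (hE hx), hxs⟩
      refine Finset.mem_coe.2 (Finset.mem_biUnion.2 ⟨c (g x), Finset.mem_univ _, ?_⟩)
      rw [if_pos ⟨_, hstep⟩]
      exact Finset.mem_image_of_mem _ hs
    · refine Finset.card_biUnion_le.trans ?_
      rw [wordCount]
      refine Finset.sum_le_sum fun B _ => ?_
      by_cases hne : (stepSet g c E B).Nonempty
      · rw [if_pos hne, if_pos ⟨hne, fun _ => Finset.mem_univ _⟩]
        exact Finset.card_image_le.trans (hcard B)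
      · simp [hne]

theorem minSubcoverCard_iteratedJoin_le (hc : ∀ A, ∃ u ∈ U, c ⁻¹' {A} ⊆ u) (n : ℕ) :
    minSubcoverCard (iteratedJoin g U (n + 1)) ≤
      ∑ A, wordCount g c Finset.univ n (c ⁻¹' {A}) := by
  classical
  choose V hV hcov hcard using fun A =>
    exists_finset_iteratedJoin_cover (g := g) hc n (c ⁻¹' {A}) (A := A) subset_rfl
  have hmem : (Finset.univ.biUnion V).card ∈ subcoverCards (iteratedJoin g U (n + 1)) := by
    refine ⟨_, ?_, ?_, rfl⟩
    · intro s hs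
      obtain ⟨A, -, hsA⟩ := Finset.mem_biUnion.1 (Finset.mem_coe.1 hs)
      exact hV A hsA
    · refine eq_univ_of_forall fun x => ?_
      obtain ⟨s, hs, hxs⟩ := hcov (c x) rfl
      exact ⟨s, Finset.mem_coe.2 (Finset.mem_biUnion.2 ⟨c x, Finset.mem_univ _, hs⟩), hxs⟩
  exact (Nat.sInf_le hmem).trans
    (Finset.card_biUnion_le.trans (Finset.sum_le_sum fun A _ => hcard A))

end Cover

/-! ### Passing to an iterate and conclusion -/

theorem iteratedJoin_iterate_subset {X : Type*} (f : X → X) (U : Set (Set X)) (m n : ℕ) :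
    iteratedJoin f^[m] (iteratedJoin f U m) n ⊆ iteratedJoin f U (n * m) := by
  rintro s ⟨v, hv, rfl⟩
  choose w hw hvw using hv
  refine ⟨fun i => w (finProdFinEquiv.symm i).1 (finProdFinEquiv.symm i).2,
    fun i => hw _ _, ?_⟩
  ext x
  simp only [hvw, mem_iInter, mem_preimage]
  rw [finProdFinEquiv.symm.forall_congr_left, Prod.forall]
  refine forall_congr' fun i => forall_congr' fun j => ?_
  simp [← Function.iterate_mul, ← Function.iterate_add_apply]

/-- Nonemptiness matters because `sInf ∅ = 0` in `ℕ`. -/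
theorem minSubcoverCard_anti {X : Type*} {U V : Set (Set X)} (h : U ⊆ V)
    (hU : (subcoverCards U).Nonempty) : minSubcoverCard V ≤ minSubcoverCard U := by
  obtain ⟨W, hW, hcov, hcard⟩ := Nat.sInf_mem hU
  exact Nat.sInf_le ⟨W, hW.trans h, hcov, hcard⟩

theorem IsProperMap.isPerfectMap {X Y : Type*} [TopologicalSpace X] [TopologicalSpace Y]
    {f : X → Y} (hf : IsProperMap f) : IsPerfectMap f :=
  ⟨hf.continuous, hf.isClosedMap, (isProperMap_iff_isClosedMap_and_compact_fibers.1 hf).2.2⟩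

/-- A polynomial factor does not affect an exponential growth rate. -/
theorem tendsto_log_mul_pow_div {K lam : ℝ} (d m : ℕ) (hm : 0 < m) :
    Tendsto (fun n : ℕ => (K + d * Real.log (n + 1) + n * (m * lam)) / (((n + 1) * m : ℕ) : ℝ))
      atTop (𝓝 lam) := by
  have hm' : (m : ℝ) ≠ 0 := by positivity
  have h1 : Tendsto (fun n : ℕ => ((n : ℝ) + 1)) atTop atTop :=
    tendsto_atTop_add_const_right _ _ tendsto_natCast_atTop_atTop
  have hlog : Tendsto (fun n : ℕ => Real.log (n + 1) / ((n : ℝ) + 1)) atTop (𝓝 0) :=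
    (Real.isLittleO_log_id_atTop.tendsto_div_nhds_zero).comp h1
  have hinv : Tendsto (fun n : ℕ => ((n : ℝ) + 1)⁻¹) atTop (𝓝 0) := tendsto_inv_atTop_zero.comp h1
  have h := ((hinv.const_mul ((K - m * lam) / m)).add (hlog.const_mul ((d : ℝ) / m))).add_const lam
  rw [mul_zero, mul_zero, zero_add, zero_add] at h
  refine h.congr fun n => ?_
  have hn : (n : ℝ) + 1 ≠ 0 := by positivity
  push_cast
  field_simp
  ring

theorem mainTheorem3 (f : ℝ → ℝ) (hf : IsPerfectMap f) (hc : 0 < cocompactEntropy f)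
    (lam : ℝ) (hlam : 0 < lam) (hlam' : (lam : EReal) < cocompactEntropy f)
    (N : ℕ) (hN : 0 < N) :
    ∃ (n p : ℕ) (J : Fin p → Set ℝ),
      N ≤ n ∧ IsHorseshoe f^[n] J ∧ lam ≤ Real.log p / n := by
  obtain ⟨U, hU⟩ := lt_iSup_iff.1 hlam'
  obtain ⟨hU, hlamU⟩ := lt_iSup_iff.1 hU
  rw [EReal.coe_lt_coe_iff] at hlamU
  by_contra! hno
  -- This `m` makes `exp (m * lam) ≥ 2`, enough to absorb the two partial steps.
  obtain ⟨m, hm⟩ := exists_nat_gt (Real.log 2 / lam)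
  have hm0 : 0 < m := by
    have : (0 : ℝ) < m := (div_pos (Real.log_pos one_lt_two) hlam).trans hm
    exact_mod_cast this
  have hx : 2 ≤ Real.exp (m * lam) := by
    rw [← Real.log_le_iff_le_exp two_pos]
    exact ((div_lt_iff₀ hlam).1 hm).le
  have hg : IsProperMap f^[m] := by
    clear hm hm0 hx
    induction m with
    | zero => exact isProperMap_id
    | succ k ih => exact ih.comp hf.isProperMap
  have hU' := hU.iteratedJoin hf m
  obtain ⟨L, c, hcm, hcs, hcU, hcfib⟩ := hU'.exists_monotone_labelling
  -- The power of the number of cells covers `k < N`, where `hno` says nothing; the `2` covers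
  -- unbounded cells and the bound `p + 1 ≤ 2 * exp (m * lam) ^ k`.
  have hF : ∀ A k, (fullCount f^[m] c A k (c ⁻¹' {A}) : ℝ) ≤
      (2 + (Fintype.card (Fin (L + 1)) : ℝ) ^ N) * Real.exp (m * lam) ^ k := by
    intro A k
    have h1 : 1 ≤ Real.exp (m * lam) ^ k := one_le_pow₀ (by linarith)
    have hcard1 : (1 : ℝ) ≤ Fintype.card (Fin (L + 1)) := by simp
    have h2 : (0 : ℝ) ≤ (Fintype.card (Fin (L + 1)) : ℝ) ^ N := by positivity
    rcases lt_or_ge k N with hk | hk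
    · have h3 : (fullCount f^[m] c A k (c ⁻¹' {A}) : ℝ) ≤
          (Fintype.card (Fin (L + 1)) : ℝ) ^ k := by
        exact_mod_cast fullCount_le_card_pow A k _
      have h4 := pow_le_pow_right₀ hcard1 hk.le
      nlinarith
    rcases hcfib A with ⟨a, b, hab, hA⟩ | hA
    · obtain ⟨p, J, hJ, hp⟩ := exists_horseshoe_of_fiber_eq_Ico hg.continuous hcm hab hA k
      rw [← Function.iterate_mul] at hJ
      have hmk : 0 < m * k := Nat.mul_pos hm0 (hN.trans_le hk)
      have h3 := hno (m * k) p J (hk.trans (Nat.le_mul_of_pos_left k hm0)) hJ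
      have hp' : (p : ℝ) ≤ Real.exp (m * lam) ^ k := by
        rcases Nat.eq_zero_or_pos p with rfl | hp0
        · simp only [Nat.cast_zero]; linarith
        · rw [div_lt_iff₀ (by exact_mod_cast hmk), Real.log_lt_iff_lt_exp (by exact_mod_cast hp0)]
            at h3
          rw [← Real.exp_nat_mul]
          refine h3.le.trans (le_of_eq ?_)
          push_cast
          ring_nf
      have h4 : (fullCount f^[m] c A k (c ⁻¹' {A}) : ℝ) ≤ p + 1 := by exact_mod_cast hp
      nlinarith
    · have h3 : (fullCount f^[m] c A k (c ⁻¹' {A}) : ℝ) ≤ 2 := by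
        exact_mod_cast fullCount_le_two_of_not_isBounded hg hcm hA k
      nlinarith
  obtain ⟨K, d, hK, hKd⟩ := exists_wordCount_le hg.continuous hcm hcs hx (by positivity) hF
    Finset.univ
  have hbound : ∀ n : ℕ, joinEntropy f U ((n + 1) * m) ≤
      Real.log ((L + 1) * K + 1) + d * Real.log (n + 1) + n * (m * lam) := by
    intro n
    -- The extra `+ 1` keeps the constant positive under the logarithm even if `K = 0`.
    have hcard : (minSubcoverCard (iteratedJoin f U ((n + 1) * m)) : ℝ) ≤
        ((L + 1) * K + 1) * (n + 1) ^ d * Real.exp (m * lam) ^ n := by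
      have h1 := (minSubcoverCard_anti (iteratedJoin_iterate_subset f U m (n + 1))
        (hU'.iteratedJoin hg.isPerfectMap (n + 1)).subcoverCards_nonempty).trans
        (minSubcoverCard_iteratedJoin_le (g := f^[m]) hcU n)
      calc (minSubcoverCard (iteratedJoin f U ((n + 1) * m)) : ℝ)
          ≤ ∑ A, (wordCount f^[m] c Finset.univ n (c ⁻¹' {A}) : ℝ) := by exact_mod_cast h1
        _ ≤ ∑ _A : Fin (L + 1), K * (n + 1) ^ d * Real.exp (m * lam) ^ n :=
            Finset.sum_le_sum fun A _ => hKd n _ (ordConnected_singleton.preimage_mono hcm)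
        _ = (L + 1) * K * (n + 1) ^ d * Real.exp (m * lam) ^ n := by
            rw [Finset.sum_const, Finset.card_univ, Fintype.card_fin, nsmul_eq_mul]
            push_cast
            ring
        _ ≤ _ := by gcongr; linarith
    have hlog : Real.log (((L + 1) * K + 1) * (n + 1) ^ d * Real.exp (m * lam) ^ n) =
        Real.log ((L + 1) * K + 1) + d * Real.log (n + 1) + n * (m * lam) := by
      rw [Real.log_mul (by positivity) (by positivity), Real.log_mul (by positivity)
        (by positivity), Real.log_pow, Real.log_pow, Real.log_exp]
    rw [← hlog, joinEntropy]
    rcases Nat.eq_zero_or_pos (minSubcoverCard (iteratedJoin f U ((n + 1) * m))) with h0 | h0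
    · rw [h0, hlog, Nat.cast_zero, Real.log_zero]
      have h1 : 0 ≤ Real.log ((L + 1) * K + 1) :=
        Real.log_nonneg (by linarith [show (0 : ℝ) ≤ (L + 1) * K by positivity])
      have h2 : 0 ≤ Real.log ((n : ℝ) + 1) := Real.log_nonneg (by simp)
      positivity
    · exact Real.log_le_log (Nat.cast_pos.2 h0) hcard
  -- The limit defining the cover entropy exists, so the lengths `(n + 1) * m` suffice to bound it
  -- by `lam`.
  have htend := (tendsto_coverEntropy hf hU).comp
    (show Tendsto (fun n : ℕ => (n + 1) * m) atTop atTop from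
      (tendsto_add_atTop_nat 1).atTop_mul_const' hm0)
  refine hlamU.not_ge (le_of_tendsto_of_tendsto' htend
    (tendsto_log_mul_pow_div (K := Real.log ((L + 1) * K + 1)) (lam := lam) d m hm0) fun n => ?_)
  exact div_le_div_of_nonneg_right (hbound n) (Nat.cast_nonneg _)
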